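/- Let $b$ be a prime, $\omega_b=e^{2\pi \mathrm{i}/b}$, and let $d,s,m\ge 1$, $t\ge 0$ be integers. Base $b$ digits of $x\in[0,1)$, $x=\xi_1b^{-1}+\xi_2b^{-2}+\cdots$, are always those with infinitely many $\xi_a\ne b-1$. A family of points $z_0,\dots,z_{b^m-1}\in[0,1)^{ds}$ is a digital $(t,m,ds)$-net over $\mathbb{Z}_b$ if (a) there are matrices $C_1,\dots,C_{ds}$ over $\mathbb{Z}_b$ with $m$ columns and $R$ rows (for some $R$) such that, for $n=n_0+n_1b+\cdots+n_{m-1}b^{m-1}$ and $(y_{n,i,1},\dots,y_{n,i,R})^\top=C_i(n_0,\dots,n_{m-1})^\top$ (entries identified with $\{0,\dots,b-1\}$), $z_{n,i}=\sum_{j=1}^{R}y_{n,i,j}b^{-j}$; and (b) for all integers $e_1,\dots,e_{ds}\ge 0$ with $e_1+\cdots+e_{ds}\le m-t$ and all $0\le a_i<b^{e_i}$, the interval $\prod_{i=1}^{ds}[a_ib^{-e_i},(a_i+1)b^{-e_i})$ contains exactly $b^{m-e_1-\cdots-e_{ds}}$ of the points (counted with multiplicity). The digit interlacing function $\mathscr{D}_d:[0,1)^d\to[0,1)$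 is $\mathscr{D}_d(x_1,\dots,x_d)=\sum_{a\ge1}\sum_{r=1}^d\xi_{r,a}b^{-r-(a-1)d}$, where $x_r=\sum_{a\ge 1}\xi_{r,a}b^{-a}$; it is injective, and $\mathscr{D}_d:[0,1)^{ds}\to[0,1)^s$ is obtained by applying it to the $s$ consecutive blocks of $d$ coordinates. For $k=\sum_{j\ge0}\kappa_jb^j\in\mathbb{N}_0$ the Walsh function is $\mathrm{wal}_k(x)=\omega_b^{\xi_1\kappa_0+\xi_2\kappa_1+\cdots}$, and $\mathrm{wal}_{(k_1,\dots,k_d)}(x_1,\dots,x_d)=\prod_{r=1}^d\mathrm{wal}_{k_r}(x_r)$. Owen's scrambling $x_\Pi$ of $x\in[0,1)^d$ replaces, for each $i$ and $a$, the $a$-th digit $\xi_{i,a}$ of $x_i$ by $\pi_{i,\xi_{i,1},\dots,\xi_{i,a-1}}(\xi_{i,a})$, where the permutations $\pi_{i,c_1,\dots,c_{a-1}}$ of $\{0,\dots,b-1\}$ ($1\le i\le d$, $a\ge1$, $c_j\in\{0,\dots,b-1\}$) are independent and uniformly distributed. For $\ell\in\mathbb{N}_0^{ds}$ let $|\ell|_1=\ell_1+\cdots+\ell_{ds}$,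 let $q=\{i\in\{1,\dots,ds\}:\ell_i\ne0\}$, and let $B_{d,\ell,s}$ be the set of all $k\in\mathbb{N}_0^{ds}$ with $\lfloor b^{\ell_i-1}\rfloor\le k_i<b^{\ell_i}$ for $1\le i\le ds$. The gain coefficient of order $d$ of points $P=\{x_0,\dots,x_{b^m-1}\}$ in the image $\mathscr{D}_d([0,1)^{ds})\subseteq[0,1)^s$ is, for an arbitrary choice of $k\in B_{d,\ell,s}$, $$\Gamma_{d,\ell}(P)=\frac1{b^{2m}}\sum_{n,n'=0}^{b^m-1}\prod_{i=1}^s\mathbb{E}\left[\mathrm{wal}_{(k_{d(i-1)+1},\dots,k_{di})}\big(\mathscr{D}_d^{-1}(x_{n,i})_{\Pi}\big)\,\overline{\mathrm{wal}_{(k_{d(i-1)+1},\dots,k_{di})}\big(\mathscr{D}_d^{-1}(x_{n',i})_{\Pi}\big)}\right].$$ **Lemma.** Let $z_0,\dots,z_{b^m-1}$ be a digital $(t,m,ds)$-net over $\mathbb{Z}_b$ and let $P_{b^m}=\{x_0,\dots,x_{b^m-1}\}$ with $x_n=\mathscr{D}_d(z_n)$. Then for every $\ell\in\mathbb{N}_0^{ds}\setminus\{0\}$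 (and for every choice of $k\in B_{d,\ell,s}$) the number $\Gamma_{d,\ell}(P_{b^m})$ is real and - $\Gamma_{d,\ell}(P_{b^m})=0$ if $|\ell|_1\le m-t$; - $\Gamma_{d,\ell}(P_{b^m})\le b^{|q|-|\ell|_1}$ if $m-t<|\ell|_1\le m-t+|q|$; - $\Gamma_{d,\ell}(P_{b^m})\le b^{-m+t}$ if $|\ell|_1>m-t+|q|$. -/

import Mathlib

open MeasureTheory

noncomputable section

namespace OwenScrambling

/-! Points live in `[0,1)^ι` and are represented as functions `ι → ℝ`. The base `b` digits of a
real number are Mathlib's `Real.digits x b`, with `Real.digits x b a` the digit of `b ^ (-(a + 1))`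
(defined by floors, so that `b`-adic rationals get their finite expansion). A family of `d * s`
coordinates is indexed by `Fin s × Fin d`: the pair `(i, r)` is coordinate `i * d + r`, the `r`-th
coordinate of the `i`-th block of length `d` (everything counted from `0`). -/

/-! ### Digital nets -/

/-- The vector of the `m` base `b` digits of `n`, least significant first, over `ZMod b`. -/
def digitVec (b m n : ℕ) : Fin m → ZMod b := fun j => ((n / b ^ (j : ℕ) % b : ℕ) : ZMod b)

/-- The points of the digital construction scheme with generating matrices `C i`
(of size `R × m`): the `i`-th coordinate of the `n`-th point is
`∑ j, y j * b ^ (-(j + 1))`, where `y = C i *ᵥ (digits of n)`. -/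
def digitalPoint {b m R : ℕ} {ι : Type} (C : ι → Matrix (Fin R) (Fin m) (ZMod b)) (n : ℕ) :
    ι → ℝ :=
  fun i => ∑ j : Fin R,
    ((Matrix.mulVec (C i) (digitVec b m n) j).val : ℝ) / (b : ℝ) ^ ((j : ℕ) + 1)

/-- `(t, m, |ι|)`-nets in base `b`: every elementary interval `∏ i, [a i / b ^ e i, (a i + 1) /
b ^ e i)` with `∑ i, e i ≤ m - t` contains the expected number `b ^ (m - ∑ i, e i)` of points
(counted with multiplicity). -/
def IsNet (b t m : ℕ) {ι : Type} [Fintype ι] (z : Fin (b ^ m) → ι → ℝ) : Prop :=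
  (∀ n i, z n i ∈ Set.Ico (0 : ℝ) 1) ∧
    ∀ e : ι → ℕ, (∑ i, e i) + t ≤ m → ∀ a : ι → ℕ, (∀ i, a i < b ^ e i) →
      Nat.card {n : Fin (b ^ m) //
        ∀ i, z n i ∈ Set.Ico ((a i : ℝ) / (b : ℝ) ^ e i) (((a i : ℝ) + 1) / (b : ℝ) ^ e i)}
        = b ^ (m - ∑ i, e i)

/-- Digital `(t, m, |ι|)`-nets over `ZMod b`: `(t, m, |ι|)`-nets that are given by the digital
construction scheme, with matrices with `m` columns and any number `R` of rows. -/
def IsDigitalNet (b t m : ℕ) {ι : Type} [Fintype ι] (z : Fin (b ^ m) → ι → ℝ) : Prop :=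
  (∃ (R : ℕ) (C : ι → Matrix (Fin R) (Fin m) (ZMod b)),
    ∀ n : Fin (b ^ m), z n = digitalPoint C n) ∧ IsNet b t m z

/-! ### Digit interlacing -/

/-- The digit interlacing function `[0,1)^d → [0,1)`:
the `a`-th digit of `x r` becomes the digit number `a * d + r` (counted from `0`). -/
def interlace (b d : ℕ) [NeZero b] (x : Fin d → ℝ) : ℝ :=
  ∑' a : ℕ, ∑ r : Fin d,
    ((Real.digits (x r) b a : ℕ) : ℝ) / (b : ℝ) ^ ((r : ℕ) + 1 + a * d)

/-- The inverse of the digit interlacing function on `[0,1)^d`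
(only meaningful on the image of `[0,1)^d`). -/
def interlaceInv (b d : ℕ) [NeZero b] : ℝ → Fin d → ℝ :=
  Function.invFunOn (interlace b d) (Set.univ.pi fun _ => Set.Ico (0 : ℝ) 1)

/-! ### Walsh functions -/

/-- The `k`-th Walsh function in base `b`: `ω ^ (∑ j, κ j * ξ j)` with `ω = exp (2 π i / b)`,
where `κ j` are the base `b` digits of `k` and `ξ j` those of `x`. -/
def walsh (b : ℕ) [NeZero b] (k : ℕ) (x : ℝ) : ℂ :=
  Complex.exp (2 * Real.pi * Complex.I / b) ^
    (∑ j ∈ Finset.range (Nat.digits b k).length, (k / b ^ j % b) * (Real.digits x b j : ℕ))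

/-- Multivariate Walsh functions. -/
def walshMulti (b : ℕ) [NeZero b] {ι : Type} [Fintype ι] (k : ι → ℕ) (x : ι → ℝ) : ℂ :=
  ∏ i, walsh b (k i) (x i)

/-! ### Owen's scrambling -/

instance instMeasurableSpacePerm (b : ℕ) : MeasurableSpace (Equiv.Perm (Fin b)) := ⊤

/-- A set of permutations for scrambling points of `[0,1)^ι`:
one permutation for each coordinate `i` and each finite string of previous digits. -/
abbrev PermFamily (b : ℕ) (ι : Type) : Type := ι × List (Fin b) → Equiv.Perm (Fin b)

/-- Owen's scrambling of a point `x` by a set of permutations: the `a`-th digit of `x i` is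
replaced by its image under the permutation with index `i` and the preceding digits of `x i`. -/
def scramble {b : ℕ} [NeZero b] {ι : Type} (P : PermFamily b ι) (x : ι → ℝ) : ι → ℝ :=
  fun i => Real.ofDigits fun a : ℕ =>
    P (i, List.ofFn fun j : Fin a => Real.digits (x i) b j) (Real.digits (x i) b a)

/-- The law of a uniformly and i.i.d. chosen set of permutations. -/
def scrambleLaw (b : ℕ) (ι : Type) : Measure (PermFamily b ι) :=
  Measure.infinitePi fun _ : ι × List (Fin b) =>
    (PMF.uniformOfFintype (Equiv.Perm (Fin b))).toMeasure

/-! ### Gain coefficients -/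

/-- The set of all `k` with `⌊b ^ (l i - 1)⌋ ≤ k i < b ^ l i` for all `i`
(here `b ^ l i / b` is a quotient of natural numbers, rounded down). -/
def walshBlock (b : ℕ) {ι : Type} (l : ι → ℕ) : Set (ι → ℕ) :=
  {k | ∀ i, b ^ l i / b ≤ k i ∧ k i < b ^ l i}

/-- The gain coefficient of order `d` of the points `x 0, …, x (b ^ m - 1)` in `[0,1)^s`, computed
with the representative `k` of a block `walshBlock b l`. -/
def gainCoeff (b d : ℕ) [NeZero b] {m s : ℕ} (x : Fin (b ^ m) → Fin s → ℝ)
    (k : Fin s × Fin d → ℕ) : ℂ :=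
  1 / (b : ℂ) ^ (2 * m) * ∑ n : Fin (b ^ m), ∑ n' : Fin (b ^ m), ∏ i : Fin s,
    ∫ P : PermFamily b (Fin d),
      walshMulti b (fun r => k (i, r)) (scramble P (interlaceInv b d (x n i))) *
        starRingEnd ℂ
          (walshMulti b (fun r => k (i, r)) (scramble P (interlaceInv b d (x n' i))))
      ∂(scrambleLaw b (Fin d))

end OwenScrambling

end

namespace OwenScrambling

/-! Interlacing is injective on `[0,1)^d`, so the gain coefficient can be computed on the net
itself. Distinct digit prefixes carry independent permutations, so the expectation for a pair of
points factors over coordinates. In one coordinate, with leading digit of `k i` at position `l i -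
1`, it equals 1 if the first `l i` digits agree, `-1/(b-1)` if exactly the first `l i - 1` do, and 0
otherwise (`integral_walshMulti_scramble`). Hence the gain is the real pair average `pairGain`.

This kernel is a combination of the indicators `agree` of common prefixes of lengths `l i` and `l i
- 1`. As long as the total prefix length is at most `m - t`, the net property counts the points
sharing given prefixes with a fixed point (`sum_prod_agree`), exactly as for independent uniform
coordinates. For `|l| ≤ m - t` the sum therefore factors, and a coordinate with `l i ≠ 0`
contributes 0. For larger `l` the kernel is at most `agree` with any `e i ≤ l i - 1`, and counting
gives the bound `b ^ (-∑ e i)` (`pairGain_le`); the two estimates differ only in the choice of `e`.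
-/

/-! ### Base `b` expansions of real numbers. -/

theorem ofDigits_lt_one {b : ℕ} {D : ℕ → Fin b} (h : ∃ a, (D a : ℕ) + 1 < b) :
    Real.ofDigits D < 1 := by
  obtain ⟨a, ha⟩ := h
  have hb : 1 < b := by omega
  rw [← Real.ofDigits_const_last_eq_one' hb]
  refine Summable.tsum_lt_tsum (i := a) (fun i => ?_) ?_ Real.summable_ofDigitsTerm
    Real.summable_ofDigitsTerm
  · have : (D i : ℕ) ≤ b - 1 := by have := (D i).2; omega
    simp only [Real.ofDigitsTerm]
    gcongr
  · have : (D a : ℕ) < b - 1 := by omega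
    simp only [Real.ofDigitsTerm]
    gcongr

theorem exists_natCast_eq_pow_mul_sum_ofDigitsTerm {b : ℕ} (D : ℕ → Fin b) (n : ℕ) :
    ∃ K : ℕ, (b : ℝ) ^ n * ∑ i ∈ Finset.range n, Real.ofDigitsTerm D i = K := by
  have hb : (b : ℝ) ≠ 0 := by exact_mod_cast (Fin.pos (D 0)).ne'
  induction n with
  | zero => exact ⟨0, by simp⟩
  | succ n ih =>
    obtain ⟨K, hK⟩ := ih
    refine ⟨b * K + D n, ?_⟩
    rw [Finset.sum_range_succ, mul_add, pow_succ', mul_assoc, hK, ← pow_succ', Real.ofDigitsTerm]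
    push_cast
    field_simp

/-- Digits are recovered from an expansion that does not end in a string of digits `b - 1`. -/
theorem digits_ofDigits {b : ℕ} [NeZero b] {D : ℕ → Fin b}
    (h : ∀ N, ∃ a, N ≤ a ∧ (D a : ℕ) + 1 < b) : Real.digits (Real.ofDigits D) b = D := by
  have hb : (b : ℝ) ≠ 0 := by simp [NeZero.ne b]
  funext n
  obtain ⟨K, hK⟩ := exists_natCast_eq_pow_mul_sum_ofDigitsTerm D n
  set τ := Real.ofDigits fun i => D (i + (n + 1)) with hτ
  have hτ1 : τ < 1 := by
    refine ofDigits_lt_one ?_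
    obtain ⟨a, ha, ha'⟩ := h (n + 1)
    exact ⟨a - (n + 1), by rwa [Nat.sub_add_cancel ha]⟩
  have hτ0 : 0 ≤ τ := Real.ofDigits_nonneg _
  -- After scaling, the integer part ends in the digit `D n` and the tail `τ` lies in `[0,1)`.
  have key : Real.ofDigits D * (b : ℝ) ^ (n + 1) = ((b * K + D n : ℕ) : ℝ) + τ := by
    rw [Real.ofDigits_eq_sum_add_ofDigits D (n + 1), ← hτ, Finset.sum_range_succ,
      Real.ofDigitsTerm]
    push_cast
    rw [← hK]
    field_simp
    ring
  have hfl : ⌊Real.ofDigits D * (b : ℝ) ^ (n + 1)⌋₊ = b * K + D n := by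
    rw [key, Nat.floor_eq_iff (by positivity)]
    constructor <;> linarith
  ext
  rw [Real.digits, hfl, Fin.val_ofNat, Nat.mul_add_mod, Nat.mod_eq_of_lt (D n).2]

/-- The digits of a number in `[0,1)` are not eventually equal to `b - 1`. -/
theorem exists_digits_lt {b : ℕ} [NeZero b] (hb : 1 < b) {x : ℝ} (hx : x ∈ Set.Ico (0 : ℝ) 1)
    (N : ℕ) : ∃ a, N ≤ a ∧ (Real.digits x b a : ℕ) + 1 < b := by
  by_contra! hcon
  have hb0 : (b : ℝ) ≠ 0 := by simp [NeZero.ne b]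
  have htail : (fun i => Real.digits x b (i + N)) =
      fun _ => (⟨b - 1, Nat.sub_one_lt_of_lt hb⟩ : Fin b) := by
    funext i
    ext
    have h1 := hcon (i + N) (by omega)
    have h2 := (Real.digits x b (i + N)).2
    simp only
    omega
  -- A tail of digits `b - 1` adds exactly `b ^ (-N)`, so `b ^ N * x` would equal its floor plus
  -- one.
  have h1 := Real.ofDigits_eq_sum_add_ofDigits (Real.digits x b) N
  rw [htail, Real.ofDigits_const_last_eq_one' hb, Real.ofDigits_digits hb hx] at h1
  have h2 := Real.ofDigits_digits_sum_eq (b := b) hx N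
  have h3 := Nat.lt_floor_add_one ((b : ℝ) ^ N * x)
  have h4 := congrArg ((b : ℝ) ^ N * ·) h1
  simp only [mul_add, mul_one, mul_inv_cancel₀ (pow_ne_zero N hb0)] at h4
  linarith

theorem eq_of_digits_eq {b : ℕ} [NeZero b] (hb : 1 < b) {x y : ℝ} (hx : x ∈ Set.Ico (0 : ℝ) 1)
    (hy : y ∈ Set.Ico (0 : ℝ) 1) (h : Real.digits x b = Real.digits y b) : x = y := by
  rw [← Real.ofDigits_digits hb hx, ← Real.ofDigits_digits hb hy, h]

/-- Two numbers share their first `n` digits iff they lie in the same `b`-adic interval of length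
`b ^ (-n)`. -/
theorem digits_agree_iff_floor_eq {b : ℕ} [NeZero b] {x y : ℝ} (hx : x ∈ Set.Ico (0 : ℝ) 1)
    (hy : y ∈ Set.Ico (0 : ℝ) 1) (n : ℕ) :
    (∀ j < n, Real.digits x b j = Real.digits y b j) ↔
      ⌊(b : ℝ) ^ n * x⌋₊ = ⌊(b : ℝ) ^ n * y⌋₊ := by
  have hb : 0 < b := NeZero.pos b
  have hdiv : ∀ z : ℝ, ∀ k, ⌊(b : ℝ) ^ (k + 1) * z⌋₊ / b = ⌊(b : ℝ) ^ k * z⌋₊ := fun z k => by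
    rw [← Nat.floor_div_natCast]
    congr 1
    field_simp
    ring
  have hdig : ∀ z : ℝ, ∀ k, (Real.digits z b k : ℕ) = ⌊(b : ℝ) ^ (k + 1) * z⌋₊ % b := fun z k => by
    rw [Real.digits, Fin.val_ofNat, mul_comm]
  induction n with
  | zero => simp [Nat.floor_eq_zero.2 hx.2, Nat.floor_eq_zero.2 hy.2]
  | succ n ih =>
    refine (Nat.forall_lt_succ_right.trans (and_congr_left' ih)).trans ?_
    rw [Fin.ext_iff, hdig, hdig]
    constructor
    · rintro ⟨h1, h2⟩
      rw [← hdiv x, ← hdiv y] at h1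
      rw [← Nat.div_add_mod ⌊(b : ℝ) ^ (n + 1) * x⌋₊ b, h1, h2, Nat.div_add_mod]
    · intro h
      rw [← hdiv x, ← hdiv y, h]
      exact ⟨rfl, rfl⟩

/-! ### Injectivity of digit interlacing. -/

theorem interlace_eq_ofDigits {b d : ℕ} [NeZero b] [NeZero d] (x : Fin d → ℝ) :
    interlace b d x =
      Real.ofDigits fun n => Real.digits (x (Nat.divModEquiv d n).2) b (Nat.divModEquiv d n).1 := by
  set D : ℕ → Fin b := fun n =>
    Real.digits (x (Nat.divModEquiv d n).2) b (Nat.divModEquiv d n).1 with hD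
  have hs : Summable fun p : ℕ × Fin d => Real.ofDigitsTerm D ((Nat.divModEquiv d).symm p) :=
    (Nat.divModEquiv d).symm.summable_iff.2 (Real.summable_ofDigitsTerm (digits := D))
  rw [Real.ofDigits, ← (Nat.divModEquiv d).symm.tsum_eq, hs.tsum_prod' fun a => .of_finite]
  unfold interlace
  refine tsum_congr fun a => ?_
  rw [tsum_fintype]
  refine Finset.sum_congr rfl fun r _ => ?_
  simp only [Real.ofDigitsTerm, hD, Equiv.apply_symm_apply]
  rw [div_eq_mul_inv]
  congr 3
  simp [Nat.divModEquiv]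
  ring

theorem interlace_injOn {b d : ℕ} [NeZero b] (hb : 1 < b) :
    Set.InjOn (interlace b d) (Set.univ.pi fun _ => Set.Ico (0 : ℝ) 1) := by
  rcases Nat.eq_zero_or_pos d with rfl | hd
  · exact Set.injOn_of_subsingleton _ _
  have : NeZero d := ⟨hd.ne'⟩
  have hdig : ∀ x : Fin d → ℝ, (∀ r, x r ∈ Set.Ico (0 : ℝ) 1) →
      Real.digits (interlace b d x) b =
        fun n => Real.digits (x (Nat.divModEquiv d n).2) b (Nat.divModEquiv d n).1 := by
    intro x hx
    rw [interlace_eq_ofDigits]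
    refine digits_ofDigits fun N => ?_
    -- One coordinate suffices: digit `a` of `x 0` lands at position `a * d ≥ a`.
    obtain ⟨a, ha, h⟩ := exists_digits_lt hb (hx 0) N
    refine ⟨(Nat.divModEquiv d).symm (a, 0), ?_, by rwa [Equiv.apply_symm_apply]⟩
    simp only [Nat.divModEquiv, Equiv.coe_fn_symm_mk]
    exact ha.trans ((Nat.le_mul_of_pos_right a hd).trans (by simp))
  intro x hx y hy hxy
  have hx' := fun r => hx r (Set.mem_univ r)
  have hy' := fun r => hy r (Set.mem_univ r)
  funext r
  refine eq_of_digits_eq hb (hx' r) (hy' r) (funext fun a => ?_)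
  have h := congrFun ((hdig x hx').symm.trans ((congrArg (Real.digits · b) hxy).trans (hdig y hy')))
    ((Nat.divModEquiv d).symm (a, r))
  simpa only [Equiv.apply_symm_apply] using h

theorem interlaceInv_interlace {b d : ℕ} [NeZero b] (hb : 1 < b) {x : Fin d → ℝ}
    (hx : ∀ r, x r ∈ Set.Ico (0 : ℝ) 1) : interlaceInv b d (interlace b d x) = x :=
  (interlace_injOn hb).leftInvOn_invFunOn fun r _ => hx r

/-! ### Averages of characters over a uniform permutation. -/

/-- The character `v ↦ exp (2 π i κ v / b)` on the digits. -/
noncomputable def digitChar (b κ : ℕ) (v : Fin b) : ℂ :=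
  Complex.exp (2 * Real.pi * Complex.I / b) ^ (κ * (v : ℕ))

theorem digitChar_mul_conj {b κ : ℕ} (v : Fin b) :
    digitChar b κ v * starRingEnd ℂ (digitChar b κ v) = 1 := by
  have : NeZero b := ⟨by have := v.2; omega⟩
  have h : ‖Complex.exp (2 * Real.pi * Complex.I / b)‖ = 1 :=
    (Complex.isPrimitiveRoot_exp b (NeZero.ne b)).norm'_eq_one (NeZero.ne b)
  rw [Complex.mul_conj, Complex.normSq_eq_norm_sq, digitChar, norm_pow, h]
  simp

theorem sum_digitChar {b κ : ℕ} (hκ : κ ≠ 0) (hκb : κ < b) : ∑ v, digitChar b κ v = 0 := by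
  have hω := Complex.isPrimitiveRoot_exp b (by omega)
  have hne := hω.pow_ne_one_of_pos_of_lt hκ hκb
  simp only [digitChar, pow_mul]
  generalize Complex.exp (2 * Real.pi * Complex.I / b) = ω at hω hne
  rw [Fin.sum_univ_eq_sum_range (fun v => (ω ^ κ) ^ v), geom_sum_eq hne, ← pow_mul, mul_comm,
    pow_mul, hω.pow_eq_one]
  simp

theorem sum_perm_comp {α M : Type*} [Fintype α] [DecidableEq α] [AddCommMonoid M]
    (f : Equiv.Perm α → M) (σ : Equiv.Perm α) : ∑ π, f (π * σ) = ∑ π, f π :=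
  Equiv.sum_comp (Equiv.mulRight σ) f

/-- A mean zero function of the image of a point under a uniform permutation has mean zero. -/
theorem sum_perm_apply_eq_zero {α : Type*} [Fintype α] [DecidableEq α] {F : α → ℂ}
    (hF : ∑ v, F v = 0) (ξ : α) : ∑ π : Equiv.Perm α, F (π ξ) = 0 := by
  have h1 : ∀ η, ∑ π : Equiv.Perm α, F (π η) = ∑ π : Equiv.Perm α, F (π ξ) := fun η => by
    rw [← sum_perm_comp _ (Equiv.swap ξ η)]
    simp
  have h2 : ∑ η, ∑ π : Equiv.Perm α, F (π η) = 0 := by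
    rw [Finset.sum_comm]
    refine Finset.sum_eq_zero fun π _ => ?_
    rw [Equiv.sum_comp π F, hF]
  simp_rw [h1] at h2
  simpa [(Fintype.card_pos_iff.2 ⟨ξ⟩).ne'] using h2

/-- By symmetry the sum is the same for every `η ≠ ξ`. Summing over all `η` gives 0 because `G` has
mean zero, and the diagonal term is the number of permutations. -/
theorem sum_perm_apply_mul {α : Type*} [Fintype α] [DecidableEq α] {F G : α → ℂ}
    (hG : ∑ v, G v = 0) (hFG : ∀ v, F v * G v = 1) {ξ η : α} (h : ξ ≠ η) :
    ((Fintype.card α : ℂ) - 1) * ∑ π : Equiv.Perm α, F (π ξ) * G (π η) =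
      -(Fintype.card (Equiv.Perm α) : ℂ) := by
  have h1 : ∀ ζ ∈ Finset.univ.erase ξ, ∑ π : Equiv.Perm α, F (π ξ) * G (π ζ) =
      ∑ π : Equiv.Perm α, F (π ξ) * G (π η) := fun ζ hζ => by
    rw [← sum_perm_comp _ (Equiv.swap η ζ)]
    simp [Equiv.swap_apply_of_ne_of_ne h (Finset.ne_of_mem_erase hζ).symm]
  have h2 : ∑ ζ, ∑ π : Equiv.Perm α, F (π ξ) * G (π ζ) = 0 := by
    rw [Finset.sum_comm]
    refine Finset.sum_eq_zero fun π _ => ?_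
    rw [← Finset.mul_sum, Equiv.sum_comp π G, hG, mul_zero]
  rw [← Finset.add_sum_erase _ _ (Finset.mem_univ ξ), Finset.sum_congr rfl h1] at h2
  simp only [hFG, Finset.sum_const, Finset.card_erase_of_mem (Finset.mem_univ ξ), nsmul_eq_mul,
    Finset.card_univ, mul_one] at h2
  rw [Nat.cast_sub (Fintype.card_pos_iff.2 ⟨ξ⟩), Nat.cast_one] at h2
  linear_combination h2

/-- The uniform distribution on the permutations of the digits. -/
noncomputable def permLaw (b : ℕ) : Measure (Equiv.Perm (Fin b)) :=
  (PMF.uniformOfFintype (Equiv.Perm (Fin b))).toMeasure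

instance (b : ℕ) : IsProbabilityMeasure (permLaw b) := by unfold permLaw; infer_instance

instance (b : ℕ) : MeasurableSingletonClass (Equiv.Perm (Fin b)) := ⟨fun _ => trivial⟩

theorem integral_permLaw {b : ℕ} (f : Equiv.Perm (Fin b) → ℂ) :
    ∫ π, f π ∂permLaw b = (Fintype.card (Equiv.Perm (Fin b)) : ℂ)⁻¹ * ∑ π, f π := by
  rw [permLaw, PMF.integral_eq_sum, Finset.mul_sum]
  simp

theorem integral_digitChar {b κ : ℕ} (hκ : κ ≠ 0) (hκb : κ < b) (ξ : Fin b) :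
    ∫ π : Equiv.Perm (Fin b), digitChar b κ (π ξ) ∂permLaw b = 0 := by
  rw [integral_permLaw, sum_perm_apply_eq_zero (sum_digitChar hκ hκb), mul_zero]

theorem integral_digitChar_mul_conj {b κ : ℕ} (hκ : κ ≠ 0) (hκb : κ < b) {ξ η : Fin b}
    (h : ξ ≠ η) :
    ∫ π : Equiv.Perm (Fin b), digitChar b κ (π ξ) * starRingEnd ℂ (digitChar b κ (π η)) ∂permLaw b =
      -1 / ((b : ℂ) - 1) := by
  have hb : (b : ℂ) - 1 ≠ 0 := by
    rw [sub_ne_zero]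
    exact_mod_cast (by omega : b ≠ 1)
  have hs : ∑ v, starRingEnd ℂ (digitChar b κ v) = 0 := by
    rw [← map_sum, sum_digitChar hκ hκb, map_zero]
  have h1 := sum_perm_apply_mul hs (fun v => digitChar_mul_conj v) h
  have h2 : (Fintype.card (Equiv.Perm (Fin b)) : ℂ) ≠ 0 := by simp [Fintype.card_ne_zero]
  rw [Fintype.card_fin] at h1
  rw [integral_permLaw, eq_div_iff hb]
  field_simp
  linear_combination h1

/-- A transposition taking `ξ` to some `w ≠ v` is excluded. The crude bound is enough: it is below 1
uniformly in `ξ` and `v`. -/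
theorem permLaw_apply_le {b : ℕ} (hb : 1 < b) (ξ v : Fin b) :
    permLaw b {π | π ξ = v} ≤ 1 - (Fintype.card (Equiv.Perm (Fin b)) : ENNReal)⁻¹ := by
  have : Nontrivial (Fin b) := Fin.nontrivial_iff_two_le.2 hb
  obtain ⟨w, hw⟩ := exists_ne v
  have hsub : {π : Equiv.Perm (Fin b) | π ξ = v} ⊆ {Equiv.swap ξ w}ᶜ := by
    rintro π hπ rfl
    exact hw (by simpa using hπ)
  refine (measure_mono hsub).trans ?_
  rw [prob_compl_eq_one_sub (measurableSet_singleton _), permLaw,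
    PMF.toMeasure_apply_singleton _ _ (measurableSet_singleton _), PMF.uniformOfFintype_apply]

/-! ### Walsh functions at scrambled points. -/

/-- The string of the first `a` digits of `x`. -/
noncomputable def digitPrefix (b : ℕ) [NeZero b] (x : ℝ) (a : ℕ) : List (Fin b) :=
  List.ofFn fun j : Fin a => Real.digits x b j

theorem length_digitPrefix {b : ℕ} [NeZero b] (x : ℝ) (a : ℕ) :
    (digitPrefix b x a).length = a := List.length_ofFn

theorem digitPrefix_injective {b : ℕ} [NeZero b] (x : ℝ) :
    Function.Injective (digitPrefix b x) := fun a a' h => by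
  rw [← length_digitPrefix (b := b) x a, h, length_digitPrefix]

theorem digitPrefix_eq_iff {b : ℕ} [NeZero b] {x y : ℝ} {a : ℕ} :
    digitPrefix b x a = digitPrefix b y a ↔ ∀ j < a, Real.digits x b j = Real.digits y b j := by
  rw [digitPrefix, digitPrefix, List.ofFn_inj, funext_iff, Fin.forall_iff]

theorem scrambleLaw_eq (b : ℕ) (ι : Type) :
    scrambleLaw b ι = Measure.infinitePi fun _ : ι × List (Fin b) => permLaw b := rfl

/-- Almost surely the scrambled digits do not end in a string of digits `b - 1`. -/
theorem ae_exists_scrambled_digit_lt {b : ℕ} [NeZero b] (hb : 1 < b) {ι : Type} (i : ι) (x : ℝ) :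
    ∀ᵐ P ∂scrambleLaw b ι, ∀ N, ∃ a, N ≤ a ∧
      (P (i, digitPrefix b x a) (Real.digits x b a) : ℕ) + 1 < b := by
  classical
  rw [ae_all_iff]
  intro N
  rw [ae_iff]
  set c : ENNReal := 1 - (Fintype.card (Equiv.Perm (Fin b)) : ENNReal)⁻¹ with hc
  have hc1 : c < 1 := ENNReal.sub_lt_self (by simp) (by simp) (by simp)
  let v : Fin b := ⟨b - 1, by omega⟩
  let t : ι × List (Fin b) → Set (Equiv.Perm (Fin b)) :=
    fun p => {π | π (Real.digits x b p.2.length) = v}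
  have hle : ∀ n : ℕ, scrambleLaw b ι {P | ¬∃ a, N ≤ a ∧
      (P (i, digitPrefix b x a) (Real.digits x b a) : ℕ) + 1 < b} ≤ c ^ n := by
    intro n
    -- Prefixes of different lengths index independent permutations, so `n` positions beyond `N`
    -- cost a factor `c` each.
    have hinj : Function.Injective fun a => (i, digitPrefix b x (N + a)) := fun a a' h =>
      Nat.add_left_cancel (digitPrefix_injective x (Prod.ext_iff.1 h).2)
    let S : Finset (ι × List (Fin b)) := (Finset.range n).map ⟨_, hinj⟩
    have hsub : {P : PermFamily b ι | ¬∃ a, N ≤ a ∧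
        (P (i, digitPrefix b x a) (Real.digits x b a) : ℕ) + 1 < b} ⊆ Set.pi S t := by
      intro P hP p hp
      obtain ⟨a, -, rfl⟩ := Finset.mem_map.1 (Finset.mem_coe.1 hp)
      simp only [Set.mem_ofPred_eq, not_exists, not_and, not_lt] at hP
      have h1 := hP (N + a) (by omega)
      simp only [t, Function.Embedding.coeFn_mk, length_digitPrefix, Set.mem_ofPred_eq]
      ext
      have h2 := (P (i, digitPrefix b x (N + a)) (Real.digits x b (N + a))).2
      simp only [v]
      omega
    refine (measure_mono hsub).trans ?_
    rw [scrambleLaw_eq, Measure.infinitePi_pi _ fun _ _ => MeasurableSpace.measurableSet_top]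
    refine (Finset.prod_le_pow_card S _ c fun p _ => permLaw_apply_le hb _ _).trans ?_
    simp [S]
  exact le_antisymm (ge_of_tendsto' (ENNReal.tendsto_pow_atTop_nhds_zero_of_lt_one hc1) hle)
    zero_le

theorem walsh_eq_prod {b : ℕ} [NeZero b] (hb : 1 < b) {k L : ℕ} (hk : k < b ^ L) (x : ℝ) :
    walsh b k x = ∏ j ∈ Finset.range L, digitChar b (k / b ^ j % b) (Real.digits x b j) := by
  have hlen : (Nat.digits b k).length ≤ L := (Nat.digits_length_le_iff hb k).2 hk
  rw [walsh, ← Finset.prod_pow_eq_pow_sum]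
  refine Finset.prod_subset (Finset.range_subset_range.2 hlen) fun j _ hj => ?_
  have h1 : k / b ^ j = 0 := Nat.div_eq_of_lt
    ((Nat.lt_base_pow_length_digits hb).trans_le
      (Nat.pow_le_pow_right (by omega) (by simpa using hj)))
  simp [h1]

theorem ae_walsh_scramble {b : ℕ} [NeZero b] (hb : 1 < b) {ι : Type} {k L : ℕ} (hk : k < b ^ L)
    (x : ι → ℝ) (i : ι) :
    ∀ᵐ P ∂scrambleLaw b ι, walsh b k (scramble P x i) =
      ∏ j ∈ Finset.range L, digitChar b (k / b ^ j % b)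
        (P (i, digitPrefix b (x i) j) (Real.digits (x i) b j)) := by
  filter_upwards [ae_exists_scrambled_digit_lt hb i (x i)] with P hP
  rw [walsh_eq_prod hb hk, scramble]
  exact Finset.prod_congr rfl fun j _ => congrArg _ (congrFun (digits_ofDigits hP) j)

theorem integral_infinitePi_finset_prod {α : Type*} {Ω : α → Type*} [∀ a, MeasurableSpace (Ω a)]
    (μ : ∀ a, Measure (Ω a)) [∀ a, IsProbabilityMeasure (μ a)] (S : Finset α)
    {g : ∀ a, Ω a → ℂ} (hg : ∀ a, Measurable (g a)) :
    ∫ P, ∏ a ∈ S, g a (P a) ∂Measure.infinitePi μ = ∏ a ∈ S, ∫ π, g a π ∂μ a := by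
  have hm : Measurable fun y : ∀ a : S, Ω a => ∏ a : S, g a (y a) :=
    Finset.measurable_fun_prod _ fun a _ => (hg a).comp (measurable_pi_apply a)
  have h := integral_restrict_infinitePi (μ := μ) (s := S) hm.aestronglyMeasurable
  rw [integral_fintype_prod_eq_prod (fun a : S => g a)] at h
  rw [Finset.prod_coe_sort S fun a => ∫ π, g a π ∂μ a] at h
  rw [← h]
  exact integral_congr_ae (.of_forall fun P => (Finset.prod_coe_sort S fun a => g a (P a)).symm)

/-! ### The expectation for a pair of scrambled points. -/

/-- The strings of the first `0, …, l - 1` digits of `x`. -/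
noncomputable def prefixes (b : ℕ) [NeZero b] (l : ℕ) (x : ℝ) : Finset (List (Fin b)) :=
  (Finset.range l).image (digitPrefix b x)

theorem mem_prefixes {b : ℕ} [NeZero b] {l : ℕ} {x : ℝ} {w : List (Fin b)} :
    w ∈ prefixes b l x ↔ w.length < l ∧ digitPrefix b x w.length = w := by
  simp only [prefixes, Finset.mem_image, Finset.mem_range]
  constructor
  · rintro ⟨j, hj, rfl⟩
    rw [length_digitPrefix]
    exact ⟨hj, rfl⟩
  · exact fun h => ⟨_, h.1, h.2⟩

/-- The contribution of the permutation with index `w` to the product of the `k`-th Walsh function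
at the scrambling of `x` and its conjugate at the scrambling of `y`. -/
noncomputable def scrambleFactor (b : ℕ) [NeZero b] (l k : ℕ) (x y : ℝ) (w : List (Fin b))
    (π : Equiv.Perm (Fin b)) : ℂ :=
  (if w ∈ prefixes b l x then
    digitChar b (k / b ^ w.length % b) (π (Real.digits x b w.length)) else 1) *
  (if w ∈ prefixes b l y then
    starRingEnd ℂ (digitChar b (k / b ^ w.length % b) (π (Real.digits y b w.length))) else 1)

theorem prod_ite_prefixes {b : ℕ} [NeZero b] {l : ℕ} {x : ℝ} {T : Finset (List (Fin b))}
    (hT : prefixes b l x ⊆ T) (f : List (Fin b) → ℂ) :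
    ∏ w ∈ T, (if w ∈ prefixes b l x then f w else 1) =
      ∏ j ∈ Finset.range l, f (digitPrefix b x j) := by
  rw [Finset.prod_ite_mem, Finset.inter_eq_right.2 hT, prefixes,
    Finset.prod_image (digitPrefix_injective x).injOn]

theorem prod_scrambleFactor {b : ℕ} [NeZero b] {l : ℕ} (k : ℕ) {x y : ℝ}
    {T : Finset (List (Fin b))} (hx : prefixes b l x ⊆ T) (hy : prefixes b l y ⊆ T)
    (P : List (Fin b) → Equiv.Perm (Fin b)) :
    ∏ w ∈ T, scrambleFactor b l k x y w (P w) =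
      (∏ j ∈ Finset.range l, digitChar b (k / b ^ j % b)
        (P (digitPrefix b x j) (Real.digits x b j))) *
      starRingEnd ℂ (∏ j ∈ Finset.range l, digitChar b (k / b ^ j % b)
        (P (digitPrefix b y j) (Real.digits y b j))) := by
  simp only [scrambleFactor]
  rw [Finset.prod_mul_distrib,
    prod_ite_prefixes hx fun w => digitChar b (k / b ^ w.length % b)
      (P w (Real.digits x b w.length)),
    prod_ite_prefixes hy fun w => starRingEnd ℂ (digitChar b (k / b ^ w.length % b)
      (P w (Real.digits y b w.length))), map_prod]
  simp only [length_digitPrefix]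

open Classical in
/-- The expectation of the product of a Walsh function with index of digit length `l` at a
scrambled point `x` and its conjugate at the scrambled point `y`. -/
noncomputable def gainKernel (b : ℕ) [NeZero b] (l : ℕ) (x y : ℝ) : ℝ :=
  if ∀ j < l, Real.digits x b j = Real.digits y b j then 1
  else if ∀ j < l - 1, Real.digits x b j = Real.digits y b j then -1 / ((b : ℝ) - 1) else 0

theorem scrambleFactor_eq_one {b : ℕ} [NeZero b] {l k : ℕ} {x y : ℝ} {w : List (Fin b)}
    (h : w ∈ prefixes b l x ↔ w ∈ prefixes b l y)
    (hd : w ∈ prefixes b l x → Real.digits x b w.length = Real.digits y b w.length)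
    (π : Equiv.Perm (Fin b)) : scrambleFactor b l k x y w π = 1 := by
  unfold scrambleFactor
  by_cases hw : w ∈ prefixes b l x
  · rw [if_pos hw, if_pos (h.1 hw), hd hw, digitChar_mul_conj]
  · rw [if_neg hw, if_neg (mt h.2 hw), one_mul]

theorem leading_digit_ne_zero {b : ℕ} {l k : ℕ} (hb : 1 < b) (hl : l ≠ 0)
    (hk : b ^ l / b ≤ k ∧ k < b ^ l) : k / b ^ (l - 1) % b ≠ 0 := by
  obtain ⟨l, rfl⟩ := Nat.exists_eq_succ_of_ne_zero hl
  rw [Nat.succ_eq_add_one, pow_succ, Nat.mul_div_cancel _ (by omega)] at hk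
  rw [Nat.succ_eq_add_one, Nat.add_sub_cancel,
    Nat.mod_eq_of_lt (Nat.div_lt_of_lt_mul hk.2)]
  exact (Nat.div_pos hk.1 (by positivity)).ne'

/-- Permutations at common prefixes followed by equal digits contribute 1. What decides is the
prefix of `x` of length `l - 1`, where the digit of `k` is nonzero: if `y` shares it but the next
digits differ, its factor is `-1/(b-1)`; if `y` does not share it, a single character remains and
averages to 0. -/
theorem prod_integral_scrambleFactor {b : ℕ} [NeZero b] (hb : 1 < b) {l k : ℕ}
    (hk : b ^ l / b ≤ k ∧ k < b ^ l) {x y : ℝ} {T : Finset (List (Fin b))}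
    (hx : prefixes b l x ⊆ T) :
    ∏ w ∈ T, ∫ π, scrambleFactor b l k x y w π ∂permLaw b = (gainKernel b l x y : ℂ) := by
  unfold gainKernel
  split_ifs with h1 h2
  · rw [Complex.ofReal_one]
    refine Finset.prod_eq_one fun w _ => ?_
    have : ∀ π, scrambleFactor b l k x y w π = 1 := by
      refine scrambleFactor_eq_one ?_ fun hw => h1 _ (mem_prefixes.1 hw).1
      rw [mem_prefixes, mem_prefixes]
      refine and_congr_right fun hw => ?_
      rw [digitPrefix_eq_iff.2 fun j hj => h1 j (hj.trans hw)]
    simp [this]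
  all_goals
    have hl : l ≠ 0 := by
      rintro rfl
      exact h1 (by simp)
    have hlast := leading_digit_ne_zero hb hl hk
    have hlt : k / b ^ (l - 1) % b < b := Nat.mod_lt _ (by omega)
    have hwx : digitPrefix b x (l - 1) ∈ prefixes b l x :=
      mem_prefixes.2 ⟨by rw [length_digitPrefix]; omega, by rw [length_digitPrefix]⟩
  · have hne : Real.digits x b (l - 1) ≠ Real.digits y b (l - 1) := fun h => h1 fun j hj => by
      rcases (show j < l - 1 ∨ j = l - 1 by omega) with hj | rfl
      · exact h2 j hj
      · exact h
    have hwy : digitPrefix b x (l - 1) ∈ prefixes b l y :=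
      mem_prefixes.2 ⟨by rw [length_digitPrefix]; omega, by
        rw [length_digitPrefix]; exact (digitPrefix_eq_iff.2 h2).symm⟩
    -- Every other prefix of `x` or `y` in play is shorter than `l - 1`, hence common to both and
    -- followed by equal digits.
    rw [Finset.prod_eq_single_of_mem _ (hx hwx)]
    · simp only [scrambleFactor, if_pos hwx, if_pos hwy, length_digitPrefix]
      rw [integral_digitChar_mul_conj hlast hlt hne]
      push_cast
      rfl
    · intro w _ hw
      have : ∀ π, scrambleFactor b l k x y w π = 1 := by
        have hcase : ∀ {u : ℝ}, digitPrefix b u (l - 1) = digitPrefix b x (l - 1) →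
            w ∈ prefixes b l u → w.length < l - 1 := fun {u} hu hwu => by
          obtain ⟨h3, h4⟩ := mem_prefixes.1 hwu
          refine lt_of_le_of_ne (by omega) fun h5 => hw ?_
          rw [← h4, h5, hu]
        refine scrambleFactor_eq_one ⟨fun h => ?_, fun h => ?_⟩ fun h => h2 _ (hcase rfl h)
        · have h3 := hcase rfl h
          rw [mem_prefixes] at h ⊢
          exact ⟨h.1, by rw [← digitPrefix_eq_iff.2 fun j hj => h2 j (hj.trans h3), h.2]⟩
        · have h3 := hcase (digitPrefix_eq_iff.2 h2).symm h
          rw [mem_prefixes] at h ⊢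
          exact ⟨h.1, by rw [digitPrefix_eq_iff.2 fun j hj => h2 j (hj.trans h3), h.2]⟩
      simp [this]
  · rw [Complex.ofReal_zero]
    refine Finset.prod_eq_zero (hx hwx) ?_
    have hwy : digitPrefix b x (l - 1) ∉ prefixes b l y := fun h => by
      have h3 := (mem_prefixes.1 h).2
      rw [length_digitPrefix] at h3
      exact h2 (digitPrefix_eq_iff.1 h3.symm)
    simp only [scrambleFactor, if_pos hwx, if_neg hwy, length_digitPrefix, mul_one]
    exact integral_digitChar hlast hlt _

/-- The expectation in the definition of the gain coefficients. -/
theorem integral_walshMulti_scramble {b : ℕ} [NeZero b] (hb : 1 < b) {ι : Type} [Fintype ι]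
    {l k : ι → ℕ} (hk : k ∈ walshBlock b l) (x y : ι → ℝ) :
    ∫ P, walshMulti b k (scramble P x) * starRingEnd ℂ (walshMulti b k (scramble P y))
      ∂scrambleLaw b ι = ((∏ i, gainKernel b (l i) (x i) (y i) : ℝ) : ℂ) := by
  classical
  -- One finite set of prefixes for all coordinates makes the index set of the product a rectangle.
  obtain ⟨T, hT⟩ : ∃ T : Finset (List (Fin b)),
      ∀ i, prefixes b (l i) (x i) ∪ prefixes b (l i) (y i) ⊆ T :=
    ⟨Finset.univ.biUnion fun i => prefixes b (l i) (x i) ∪ prefixes b (l i) (y i), fun i =>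
      Finset.subset_biUnion_of_mem
        (fun i => prefixes b (l i) (x i) ∪ prefixes b (l i) (y i)) (Finset.mem_univ i)⟩
  have hTx := fun i => Finset.subset_union_left.trans (hT i)
  have hTy := fun i => Finset.subset_union_right.trans (hT i)
  obtain ⟨g, hg⟩ : ∃ g : ι × List (Fin b) → Equiv.Perm (Fin b) → ℂ,
      ∀ p, g p = scrambleFactor b (l p.1) (k p.1) (x p.1) (y p.1) p.2 := ⟨_, fun _ => rfl⟩
  have hae : (fun P => walshMulti b k (scramble P x) *
      starRingEnd ℂ (walshMulti b k (scramble P y))) =ᵐ[scrambleLaw b ι]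
        fun P => ∏ p ∈ Finset.univ ×ˢ T, g p (P p) := by
    filter_upwards [ae_all_iff.2 fun i => ae_walsh_scramble hb (hk i).2 x i,
      ae_all_iff.2 fun i => ae_walsh_scramble hb (hk i).2 y i] with P hPx hPy
    rw [Finset.prod_product, walshMulti, walshMulti, map_prod, ← Finset.prod_mul_distrib]
    refine Finset.prod_congr rfl fun i _ => ?_
    rw [hPx, hPy]
    simp only [hg]
    exact (prod_scrambleFactor (k i) (hTx i) (hTy i) fun w => P (i, w)).symm
  have hgm : ∀ p, Measurable (g p) := fun _ => measurable_from_top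
  rw [integral_congr_ae hae, scrambleLaw_eq, integral_infinitePi_finset_prod _ _ hgm,
    Finset.prod_product, Complex.ofReal_prod]
  refine Finset.prod_congr rfl fun i _ => ?_
  simp only [hg]
  exact prod_integral_scrambleFactor hb (hk i) (hTx i)

/-! ### Counting common prefixes in a net. -/

open Classical in
/-- The indicator function of the pairs of numbers that share their first `e` digits. -/
noncomputable def agree (b : ℕ) [NeZero b] (e : ℕ) (x y : ℝ) : ℝ :=
  if ∀ j < e, Real.digits x b j = Real.digits y b j then 1 else 0

theorem agree_zero {b : ℕ} [NeZero b] (x y : ℝ) : agree b 0 x y = 1 := by simp [agree]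

theorem sum_prod_agree {b t m : ℕ} [NeZero b] {ι : Type} [Fintype ι] {z : Fin (b ^ m) → ι → ℝ}
    (hz : IsNet b t m z) {e : ι → ℕ} (he : ∑ i, e i + t ≤ m) (n : Fin (b ^ m)) :
    ∑ n', ∏ i, agree b (e i) (z n i) (z n' i) = (b : ℝ) ^ m * ∏ i, ((b : ℝ) ^ e i)⁻¹ := by
  classical
  have hb : 0 < b := NeZero.pos b
  have hfl : ∀ i, ⌊(b : ℝ) ^ e i * z n i⌋₊ < b ^ e i := fun i => by
    rw [Nat.floor_lt' (by positivity), Nat.cast_pow]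
    exact mul_lt_of_lt_one_right (by positivity) (hz.1 n i).2
  -- The elementary interval chosen is the one containing `z n`.
  have hcard := hz.2 e he _ hfl
  have hiff : ∀ n' i, z n' i ∈ Set.Ico ((⌊(b : ℝ) ^ e i * z n i⌋₊ : ℝ) / (b : ℝ) ^ e i)
      (((⌊(b : ℝ) ^ e i * z n i⌋₊ : ℝ) + 1) / (b : ℝ) ^ e i) ↔
        ∀ j < e i, Real.digits (z n i) b j = Real.digits (z n' i) b j := fun n' i => by
    rw [digits_agree_iff_floor_eq (hz.1 n i) (hz.1 n' i), eq_comm, Nat.floor_eq_iff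
      (mul_nonneg (by positivity) (hz.1 n' i).1), Set.mem_Ico, div_le_iff₀' (by positivity),
      lt_div_iff₀' (by positivity)]
  simp only [hiff] at hcard
  rw [Nat.card_eq_fintype_card, Fintype.card_subtype] at hcard
  have hprod : ∀ n', ∏ i, agree b (e i) (z n i) (z n' i) =
      if ∀ i, ∀ j < e i, Real.digits (z n i) b j = Real.digits (z n' i) b j then 1 else 0 :=
    fun n' => by
      simp only [agree]
      rw [Finset.prod_ite_zero]
      simp
  rw [Finset.sum_congr rfl fun n' _ => hprod n', Finset.sum_boole, hcard, Finset.prod_inv_distrib,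
    Finset.prod_pow_eq_pow_sum, Nat.cast_pow, pow_sub₀ _ (by positivity) (by omega)]

/-- Each term of the expanded product has exponents at most `l i`, so the net count applies to it
and the results refactor. -/
theorem sum_prod_sum_agree {b t m : ℕ} [NeZero b] {ι κ : Type} [Fintype ι] [Fintype κ]
    {z : Fin (b ^ m) → ι → ℝ} (hz : IsNet b t m z) {l : ι → ℕ} (hl : ∑ i, l i + t ≤ m)
    {e : ι → κ → ℕ} (he : ∀ i c, e i c ≤ l i) (f : ι → κ → ℝ) (n : Fin (b ^ m)) :
    ∑ n', ∏ i, ∑ c, f i c * agree b (e i c) (z n i) (z n' i) =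
      (b : ℝ) ^ m * ∏ i, ∑ c, f i c * ((b : ℝ) ^ e i c)⁻¹ := by
  classical
  simp only [Finset.prod_univ_sum, Finset.prod_mul_distrib]
  rw [Finset.sum_comm, Finset.mul_sum]
  refine Finset.sum_congr rfl fun c _ => ?_
  rw [← Finset.mul_sum, sum_prod_agree hz (e := fun i => e i (c i))
    ((Nat.add_le_add_right (Finset.sum_le_sum fun i _ => he i (c i)) t).trans hl) n]
  ring

/-- For `l ≠ 0` this is `(b * agree l - agree (l - 1)) / (b - 1)`; for `l = 0`, where `l - 1`
truncates, the second weight is 0. The sum over `Bool` fits `sum_prod_sum_agree`. -/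
theorem gainKernel_eq_sum_agree {b : ℕ} [NeZero b] (hb : 1 < b) (l : ℕ) (x y : ℝ) :
    gainKernel b l x y = ∑ c : Bool,
      (bif c then (if l = 0 then 1 else (b : ℝ) / (b - 1)) else if l = 0 then 0 else -1 / (b - 1)) *
        agree b (bif c then l else l - 1) x y := by
  have hb1 : (b : ℝ) - 1 ≠ 0 := by
    rw [sub_ne_zero]
    exact_mod_cast hb.ne'
  simp only [Fintype.sum_bool, cond_true, cond_false]
  rcases Nat.eq_zero_or_pos l with rfl | hl
  · simp [gainKernel, agree]
  rw [if_neg hl.ne', if_neg hl.ne', gainKernel, agree, agree]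
  split_ifs with h1 h2 h2
  · field_simp
    ring
  · exact absurd (fun j hj => h1 j (by omega)) h2
  · ring
  · ring

theorem sum_prod_gainKernel_eq_zero {b t m : ℕ} [NeZero b] (hb : 1 < b) {ι : Type} [Fintype ι]
    {z : Fin (b ^ m) → ι → ℝ} (hz : IsNet b t m z) {l : ι → ℕ} (hl : ∑ i, l i + t ≤ m)
    (hl0 : l ≠ 0) (n : Fin (b ^ m)) : ∑ n', ∏ i, gainKernel b (l i) (z n i) (z n' i) = 0 := by
  simp only [gainKernel_eq_sum_agree hb]
  rw [sum_prod_sum_agree hz hl (fun i c => by cases c <;> simp)]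
  -- The factor at such an `i` is `(b * b ^ (-l i) - b ^ (-(l i - 1))) / (b - 1) = 0`.
  obtain ⟨i, hi⟩ := Function.ne_iff.1 hl0
  rw [Finset.prod_eq_zero (Finset.mem_univ i), mul_zero]
  obtain ⟨a, ha⟩ := Nat.exists_eq_succ_of_ne_zero hi
  have hb0 : (b : ℝ) ≠ 0 := by simp [NeZero.ne b]
  simp only [Fintype.sum_bool, cond_true, cond_false, ha, Nat.succ_eq_add_one, Nat.add_sub_cancel,
    Nat.add_eq_zero_iff, one_ne_zero, and_false, if_false]
  rw [pow_succ]
  field_simp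
  ring

/-- The kernel vanishes unless the first `l - 1` digits agree, and `1/(b-1) ≤ 1` since `b ≥ 2`. -/
theorem abs_gainKernel_le_agree {b : ℕ} [NeZero b] (hb : 1 < b) {e l : ℕ} (h : e ≤ l - 1)
    (x y : ℝ) : |gainKernel b l x y| ≤ agree b e x y := by
  have hb1 : (1 : ℝ) ≤ (b : ℝ) - 1 := by
    have : (2 : ℝ) ≤ b := by exact_mod_cast hb
    linarith
  have hb2 : |-1 / ((b : ℝ) - 1)| ≤ 1 := by
    rw [abs_div, abs_neg, abs_one, abs_of_pos (by linarith)]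
    exact (div_le_one (by linarith)).2 hb1
  unfold gainKernel agree
  split_ifs with h1 h2 h3 h4 h5
  · simp
  · exact absurd (fun j hj => h1 j (by omega)) h2
  · exact hb2
  · exact absurd (fun j hj => h3 j (by omega)) h4
  · simp
  · simp

theorem prod_gainKernel_le {b : ℕ} [NeZero b] (hb : 1 < b) {ι : Type} [Fintype ι] {e l : ι → ℕ}
    (h : ∀ i, e i ≤ l i - 1) (x y : ι → ℝ) :
    ∏ i, gainKernel b (l i) (x i) (y i) ≤ ∏ i, agree b (e i) (x i) (y i) := by
  refine (le_abs_self _).trans ?_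
  rw [Finset.abs_prod]
  exact Finset.prod_le_prod (fun _ _ => abs_nonneg _) fun i _ => abs_gainKernel_le_agree hb (h i) _ _

/-! ### Bounds for the gain coefficient. -/

/-- The gain coefficient as an average over pairs of points. -/
noncomputable def pairGain (b m : ℕ) [NeZero b] {ι : Type} [Fintype ι] (z : Fin (b ^ m) → ι → ℝ)
    (l : ι → ℕ) : ℝ :=
  1 / (b : ℝ) ^ (2 * m) * ∑ n, ∑ n', ∏ i, gainKernel b (l i) (z n i) (z n' i)

theorem pairGain_le {b t m : ℕ} [NeZero b] (hb : 1 < b) {ι : Type} [Fintype ι]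
    {z : Fin (b ^ m) → ι → ℝ} (hz : IsNet b t m z) {e l : ι → ℕ} (he : ∀ i, e i ≤ l i - 1)
    (het : ∑ i, e i + t ≤ m) : pairGain b m z l ≤ ((b : ℝ) ^ ∑ i, e i)⁻¹ := by
  have hb0 : (0 : ℝ) < b := by exact_mod_cast NeZero.pos b
  calc pairGain b m z l
      ≤ 1 / (b : ℝ) ^ (2 * m) * ∑ n, ∑ n', ∏ i, agree b (e i) (z n i) (z n' i) := by
        unfold pairGain
        refine mul_le_mul_of_nonneg_left (Finset.sum_le_sum fun n _ => Finset.sum_le_sum fun n' _ =>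
          prod_gainKernel_le hb he _ _) (by positivity)
    _ = ((b : ℝ) ^ ∑ i, e i)⁻¹ := by
        simp only [sum_prod_agree hz het]
        rw [Finset.sum_const, Finset.card_univ, Fintype.card_fin, nsmul_eq_mul,
          Finset.prod_inv_distrib, Finset.prod_pow_eq_pow_sum, Nat.cast_pow, two_mul, pow_add]
        field_simp

theorem pairGain_le_one {b m : ℕ} [NeZero b] (hb : 1 < b) {ι : Type} [Fintype ι]
    (z : Fin (b ^ m) → ι → ℝ) (l : ι → ℕ) : pairGain b m z l ≤ 1 := by
  have hb0 : (0 : ℝ) < b := by exact_mod_cast NeZero.pos b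
  calc pairGain b m z l
      ≤ 1 / (b : ℝ) ^ (2 * m) * ∑ _ : Fin (b ^ m), ∑ _ : Fin (b ^ m), 1 := by
        unfold pairGain
        gcongr with n _ n' _
        refine (prod_gainKernel_le hb (e := 0) (fun i => Nat.zero_le _) _ _).trans_eq ?_
        simp [agree_zero]
    _ = 1 := by
        simp only [Finset.sum_const, Finset.card_univ, Fintype.card_fin, nsmul_eq_mul, mul_one,
          Nat.cast_pow]
        rw [two_mul, pow_add]
        field_simp

theorem exists_le_sum_eq {ι : Type*} [Fintype ι] (f : ι → ℕ) {M : ℕ} (hM : M ≤ ∑ i, f i) :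
    ∃ e : ι → ℕ, (∀ i, e i ≤ f i) ∧ ∑ i, e i = M := by
  classical
  induction M with
  | zero => exact ⟨0, by simp⟩
  | succ M ih =>
    obtain ⟨e, he, hs⟩ := ih (by omega)
    obtain ⟨i, -, hi⟩ := Finset.exists_lt_of_sum_lt (show ∑ i, e i < ∑ i, f i by omega)
    refine ⟨e + Pi.single i 1, fun j => ?_, ?_⟩
    · rcases eq_or_ne j i with rfl | hj
      · simpa using hi
      · simpa [hj] using he j
    · simp [Finset.sum_add_distrib, hs]

theorem gainCoeff_interlace {b d s m : ℕ} [NeZero b] (hb : 1 < b)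
    {z : Fin (b ^ m) → Fin s × Fin d → ℝ} (hz : ∀ n p, z n p ∈ Set.Ico (0 : ℝ) 1)
    {x : Fin (b ^ m) → Fin s → ℝ} (hx : ∀ n i, x n i = interlace b d fun r => z n (i, r))
    {l k : Fin s × Fin d → ℕ} (hk : k ∈ walshBlock b l) :
    gainCoeff b d x k = (pairGain b m z l : ℂ) := by
  have hinv : ∀ n i, interlaceInv b d (x n i) = fun r => z n (i, r) := fun n i => by
    rw [hx, interlaceInv_interlace hb fun r => hz n (i, r)]
  unfold gainCoeff pairGain
  simp only [hinv]
  push_cast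
  congr 1
  refine Finset.sum_congr rfl fun n _ => Finset.sum_congr rfl fun n' _ => ?_
  rw [Fintype.prod_prod_type]
  refine Finset.prod_congr rfl fun i _ => ?_
  rw [integral_walshMulti_scramble hb (l := fun r => l (i, r)) fun r => hk (i, r)]
  push_cast
  rfl

end OwenScrambling

theorem mainTheorem3 (b d s t m : ℕ) [Fact b.Prime]
    (z : Fin (b ^ m) → Fin s × Fin d → ℝ)
    (hz : OwenScrambling.IsDigitalNet b t m z)
    (x : Fin (b ^ m) → Fin s → ℝ)
    (hx : ∀ n i, x n i = OwenScrambling.interlace b d (fun r => z n (i, r)))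
    (l : Fin s × Fin d → ℕ) (hl : l ≠ 0)
    (q : Finset (Fin s × Fin d)) (hq : ∀ p, p ∈ q ↔ l p ≠ 0)
    (k : Fin s × Fin d → ℕ) (hk : k ∈ OwenScrambling.walshBlock b l) :
    ∃ γ : ℝ, OwenScrambling.gainCoeff b d x k = (γ : ℂ) ∧
      (((∑ p, l p : ℕ) : ℤ) ≤ (m : ℤ) - t → γ = 0) ∧
      ((m : ℤ) - t < ((∑ p, l p : ℕ) : ℤ) →
        ((∑ p, l p : ℕ) : ℤ) ≤ (m : ℤ) - t + q.card →
          γ ≤ (b : ℝ) ^ ((q.card : ℤ) - ((∑ p, l p : ℕ) : ℤ))) ∧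
      ((m : ℤ) - t + q.card < ((∑ p, l p : ℕ) : ℤ) → γ ≤ (b : ℝ) ^ (-(m : ℤ) + t)) := by
  have hb : 1 < b := (Fact.out : b.Prime).one_lt
  obtain ⟨-, hnet⟩ := hz
  -- The truncated `l p - 1` loses one exactly on `q`, so these exponents sum to `|l| - |q|`.
  have hsum : ∑ p, (l p - 1) + q.card = ∑ p, l p := by
    have hq' : q = Finset.univ.filter fun p => l p ≠ 0 := by
      ext p
      simp [hq]
    rw [hq', Finset.card_filter, ← Finset.sum_add_distrib]
    refine Finset.sum_congr rfl fun p _ => ?_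
    split_ifs with h <;> omega
  refine ⟨OwenScrambling.pairGain b m z l,
    OwenScrambling.gainCoeff_interlace hb hnet.1 hx hk, fun h => ?_, fun _ h => ?_, fun h => ?_⟩
  · rw [OwenScrambling.pairGain, Finset.sum_eq_zero, mul_zero]
    exact fun n _ => OwenScrambling.sum_prod_gainKernel_eq_zero hb hnet (by omega) hl n
  · refine (OwenScrambling.pairGain_le hb hnet (fun p => le_refl (l p - 1)) (by omega)).trans_eq ?_
    rw [← zpow_natCast, ← zpow_neg]
    congr 1
    omega
  · rcases le_or_gt t m with htm | htm
    -- Here `l p - 1` is too long for the net property, so it is shortened to total length exactly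
    -- `m - t`.
    · obtain ⟨e, he, hes⟩ := OwenScrambling.exists_le_sum_eq (fun p => l p - 1)
        (M := m - t) (by omega)
      refine (OwenScrambling.pairGain_le hb hnet he (by omega)).trans_eq ?_
      rw [hes, ← zpow_natCast, ← zpow_neg]
      congr 1
      omega
    -- For `t > m` the net property says nothing, but the claimed bound is at least 1.
    · refine (OwenScrambling.pairGain_le_one hb z l).trans ?_
      exact one_le_zpow₀ (by exact_mod_cast hb.le) (by omega)
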